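/- Let $d\in\mathbb N$, let $(g_t)_{t\ge1}\subset\mathbb R^d$ be a sequence of (sub-)gradients with $\|g_1\|>0$ ($\|\cdot\|$ is the Euclidean norm), and let $(h_t)_{t\ge1}$ be a non-decreasing sequence of real hints with $h_t\ge L_t:=\max_{1\le s\le t}\|g_s\|$ for all $t\ge1$. The algorithm FreeRange keeps an epoch start $\tau$, initially $\tau=1$. In each round $t=1,2,\dots$ it observes the hint $h_t$; if $h_t/h_\tau>\sum_{s=1}^{t-1}\|g_s\|/h_s+2$, it sets $\tau=t$. With this $\tau$, let $V=h_\tau^2+\sum_{s=\tau}^{t-1}\|g_s\|^2$ and $G=\sum_{s=\tau}^{t-1}g_s$; it then outputs the FreeGrad iterate $$\hat w_t=-G\cdot\frac{(2V+h_t\|G\|)\,h_\tau^2}{2(V+h_t\|G\|)^2\sqrt V}\cdot\exp\Big(\frac{\|G\|^2}{2V+2h_t\|G\|}\Big),$$ and afterwards $g_t$ is revealed. Then, for all $w\in\mathbb R^d$ and $T\ge1$, $$\sum_{t=1}^T\langle g_t,\hat w_t-w\rangle\le 2\|w\|\sqrt{2V_T\ln_+(\|w\|b_T)}+h_T\big(16\|w\|\ln_+(2\|w\|b_T)+2\|w\|+3\big),$$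 where $\ln_+(x)=\max(0,\ln x)$ (with $\ln_+(0)=0$), $V_T=h_1^2+\sum_{t=1}^T\|g_t\|^2$, and $$b_T=2\sum_{t=1}^T\Big(\sum_{s=1}^{t-1}\frac{\|g_s\|}{h_s}+2\Big)^2\le(T+1)^3 .$$ -/

import Mathlib

open scoped NNReal

noncomputable section

/-- `ln₊ x = max 0 (ln x)`; at `x = 0` this is `0`, since `Real.log 0 = 0`. -/
def lnPlus (x : ℝ) : ℝ := max 0 (Real.log x)

section
variable {d : ℕ}

/-- The running maximum gradient norm `L_t = max_{1 ≤ s ≤ t} ‖g_s‖`, with `L_0 = 0`.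
Rounds are numbered from `1`; the entry of a sequence at `0` is never used. -/
def runningMax (g : ℕ → EuclideanSpace ℝ (Fin d)) (t : ℕ) : ℝ :=
  (((Finset.Icc 1 t).sup fun s => ‖g s‖₊ : ℝ≥0) : ℝ)

/-- `(h_t)_{t ≥ 1}` is a sequence of hints for `(g_t)_{t ≥ 1}`: it is non-decreasing and
`h_t ≥ L_t` in every round. -/
structure IsHintSequence (g : ℕ → EuclideanSpace ℝ (Fin d)) (h : ℕ → ℝ) : Prop where
  monotoneOn : MonotoneOn h (Set.Ici 1)
  runningMax_le : ∀ t, 1 ≤ t → runningMax g t ≤ h t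

/-- The FreeGrad iterate, as a function of the initial hint `h₁`, the current hint `h`, and the
statistics `V = h₁² + ∑ ‖g_s‖²` and `G = ∑ g_s` of the past sub-gradients. -/
def freeGradIterate (h₁ h V : ℝ) (G : EuclideanSpace ℝ (Fin d)) : EuclideanSpace ℝ (Fin d) :=
  -(((2 * V + h * ‖G‖) * h₁ ^ 2 / (2 * (V + h * ‖G‖) ^ 2 * Real.sqrt V) *
      Real.exp (‖G‖ ^ 2 / (2 * V + 2 * h * ‖G‖))) • G)

/-- The value of the FreeRange variable `τ` (start of the current epoch) when the output of round
`t` is computed; its value before the first round is `1`. In round `t + 1` a new epoch starts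
iff `h_{t+1} / h_τ > ∑_{s ≤ t} ‖g_s‖ / h_s + 2`. -/
def epochStart (g : ℕ → EuclideanSpace ℝ (Fin d)) (h : ℕ → ℝ) : ℕ → ℕ
  | 0 => 1
  | t + 1 =>
    if h (t + 1) / h (epochStart g h t) > (∑ s ∈ Finset.Icc 1 t, ‖g s‖ / h s) + 2
    then t + 1
    else epochStart g h t

/-- The output of FreeRange in round `t ≥ 1`: the FreeGrad iterate computed from the hints and
sub-gradients of the current epoch `τ, …, t - 1`, and from the hint of round `t`. -/
def freeRange (g : ℕ → EuclideanSpace ℝ (Fin d)) (h : ℕ → ℝ) (t : ℕ) :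
    EuclideanSpace ℝ (Fin d) :=
  freeGradIterate (h (epochStart g h t)) (h t)
    (h (epochStart g h t) ^ 2 + ∑ s ∈ Finset.Ico (epochStart g h t) t, ‖g s‖ ^ 2)
    (∑ s ∈ Finset.Ico (epochStart g h t) t, g s)

/-- `V_T = h_1² + ∑_{t ≤ T} ‖g_t‖²`. -/
def gradVariance (g : ℕ → EuclideanSpace ℝ (Fin d)) (h : ℕ → ℝ) (T : ℕ) : ℝ :=
  h 1 ^ 2 + ∑ t ∈ Finset.Icc 1 T, ‖g t‖ ^ 2

/-- `b_T = 2 ∑_{t ≤ T} (∑_{s < t} ‖g_s‖ / h_s + 2)²`. -/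
def rangeFactor (g : ℕ → EuclideanSpace ℝ (Fin d)) (h : ℕ → ℝ) (T : ℕ) : ℝ :=
  2 * ∑ t ∈ Finset.Icc 1 T, ((∑ s ∈ Finset.Ico 1 t, ‖g s‖ / h s) + 2) ^ 2

end

end

/-! FreeGrad is governed by the potential `h₁ ^ 2 * freeGradPotential h V G`: each round it drops by
at least the loss suffered (`inner_freeGradIterate_le`), and raising the hint only lowers it. An
epoch starts with potential `h_τ`, so its losses total at most `h_τ` minus its final potential. A
restart at least doubles `h_τ`, so the initial potentials add up geometrically to at most `2 * h_τ`
(`sum_inner_freeRange_add_le`).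

The comparator term splits over three blocks. On each of the last two epochs, the convex conjugate
of the retained potential pays for `‖w‖ * ‖G‖` (`mul_norm_sub_freeGradPotential_le`). All earlier
gradients together have norm at most `h_T`, by the restart condition itself
(`sum_norm_le_of_restart`). Between restarts the hint stays below `h_τ` times the threshold, which
bounds the ratio of `V` to `h_τ ^ 2` inside the logarithm by half of `b_T`
(`two_mul_epochVariance_le`).

The analytic core is the one-step drop. Scaled to hint one, it becomes `log_potential_step`, split
according to whether the old sum is long or the gradient does not oppose it, and otherwise according
to the size of `V`. -/

/-! ### Polynomial inequalities for a short gradient sum -/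

lemma cubic_nonneg {m r : ℝ} (hm : 0 ≤ m) (hm1 : m ≤ 1) (hr : 0 ≤ r) (hr1 : r ≤ 1) :
  0 ≤ r+2-2*m-2*(2*m-m^2)*(r+1-2*m) := by
  have h0 : 0 ≤ 2-2*m-2*(2*m-m^2)*(1-2*m) := by
    nlinarith [sq_nonneg (m-1/4), mul_nonneg hm (sub_nonneg.2 hm1),
      mul_nonneg (mul_nonneg hm hm) (sub_nonneg.2 hm1)]
  have h1 : 0 ≤ 3-2*m-2*(2*m-m^2)*(2-2*m) := by
    nlinarith [sq_nonneg (m-1/2), sq_nonneg (m-3/5), mul_nonneg hm (sub_nonneg.2 hm1),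
      mul_nonneg (sub_nonneg.2 hm1) (sq_nonneg (m-2/5)), mul_nonneg hm (sq_nonneg (m-1))]
  nlinarith [mul_nonneg hr h1, mul_nonneg (sub_nonneg.2 hr1) h0]

lemma quartic_nonneg {m r : ℝ} (hm : 0 ≤ m) (hm1 : m ≤ 1) (hr : 0 ≤ r) (hr1 : r ≤ 1) :
  0 ≤ (r+2-2*m)*(r/9+m)-(2*m-m^2)*(r+1-2*m)*(11/9)*r := by
  -- Expansion in the Bernstein basis of degree two in `r`; each coefficient is nonnegative.
  have e : (r+2-2*m)*(r/9+m)-(2*m-m^2)*(r+1-2*m)*(11/9)*r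
    = (1-r)^2*(2*m*(1-m)) + (1-r)*r*(2*(1-m)/9+m+ 4*m*(1-m)-(2*m-m^2)*(1-2*m)*(11/9))
      + r^2*((1+2*(1-m))*(1/9+m)-(2*m-m^2)*(2-2*m)*(11/9)) := by ring
  have h0 : 0 ≤ (2*(1-m)/9+m+ 4*m*(1-m)-(2*m-m^2)*(1-2*m)*(11/9)) := by
    nlinarith [mul_nonneg hm (sub_nonneg.2 hm1), mul_nonneg (mul_nonneg hm hm) (sub_nonneg.2 hm1)]
  have h1 : 0 ≤ ((1+2*(1-m))*(1/9+m)-(2*m-m^2)*(2-2*m)*(11/9)) := by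
    nlinarith [mul_nonneg hm (sub_nonneg.2 hm1),
      mul_nonneg (sub_nonneg.2 hm1) (sq_nonneg (m-1/5)), mul_nonneg hm (sq_nonneg
        (m-1/5)),sq_nonneg (m-1/5), mul_nonneg hm (sq_nonneg (m-1/3)), mul_nonneg hm (sq_nonneg
        (m-1)), mul_nonneg (mul_nonneg hm hm) (sub_nonneg.2 hm1)]
  rw [e]
  have := sub_nonneg.2 hm1
  have := sub_nonneg.2 hr1
  positivity

/-- When `r+1-m-a` is positive, the worst case is `a = m`. The difference of the sides is then
affine in `y`: `cubic_nonneg` is its slope and `quartic_nonneg` its value at `y = r / 9`. -/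
lemma short_sum_polynomial {a m r y : ℝ} (ha1 : a ≤ 1) (hm : 0 ≤ m) (hma : m ≤ a) (hr : 0 ≤ r)
    (hr1 : r ≤ 1) (hy : r / 9 ≤ y) :
    (2*m-a^2)*(r+1-m-a)*(2*y+r) ≤ (r+2-2*m)*(y+a) := by
  have hy0 : 0 ≤ y := by linarith
  have hm1 : m ≤ 1 := by linarith
  by_cases hY : r+1-m-a ≤ 0
  · by_cases hX : 0 ≤ 2*m-a^2
    · have h1 := mul_nonpos_of_nonneg_of_nonpos hX hY
      have h2 := mul_nonpos_of_nonpos_of_nonneg h1 (by positivity : 0 ≤ 2*y+r)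
      have h3 : 0 ≤ (r+2-2*m)*(y+a) := mul_nonneg (by linarith) (by linarith)
      linarith
    · push Not at hX
      have h1 : (a^2-2*m)*(m+a-r-1) ≤ 1 * m := mul_le_mul (by nlinarith) (by linarith)
          (by linarith) (by linarith)
      have h2 := mul_le_mul_of_nonneg_right h1 (by positivity : 0 ≤ 2*y+r)
      nlinarith [mul_nonneg hm hy0, mul_nonneg hr hy0, mul_nonneg hm hr,
        mul_nonneg hr (sub_nonneg.2 hma), mul_nonneg (sub_nonneg.2 ha1) hy0, mul_nonneg
          (sub_nonneg.2 hm1) (sub_nonneg.2 hma), mul_nonneg (sub_nonneg.2 ha1) hr]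
  · push Not at hY
    have h1 : (2*m-a^2)*(r+1-m-a) ≤ (2*m-m^2)*(r+1-2*m) :=
      mul_le_mul (by nlinarith) (by linarith) hY.le (by nlinarith)
    have h2 := mul_le_mul_of_nonneg_right h1 (by positivity : 0 ≤ 2*y+r)
    have h3 := mul_nonneg (cubic_nonneg hm hm1 hr hr1) (sub_nonneg.2 hy)
    have h4 := quartic_nonneg hm hm1 hr hr1
    have h5 : (r+2-2*m)*(y+m) ≤ (r+2-2*m)*(y+a) := by gcongr; linarith
    nlinarith

/-! ### The one-step inequality for a hint equal to one -/

lemma exp_neg_le_quadratic {y : ℝ} (hy : 0 ≤ y) : Real.exp (-y) ≤ 1 - y + y ^ 2 / 2 := by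
  have h1 := Real.quadratic_le_exp_of_nonneg hy
  rw [Real.exp_neg]
  apply inv_le_of_inv_le₀ (by nlinarith [sq_nonneg (y - 1)])
  refine le_trans ?_ h1
  rw [inv_le_iff_one_le_mul₀ (by nlinarith [sq_nonneg (y - 1)])]
  nlinarith [sq_nonneg (y ^ 2)]

lemma one_add_slope_mul_ge {p c : ℝ} (hp : 0 ≤ p) (hp1 : p ≤ 1) (hc : |c| ≤ 1) :
    1 / 2 ≤ 1 + (p - p ^ 2 / 2) * c := by
  have ⟨h1, h2⟩ := abs_le.1 hc
  have hk : 0 ≤ p - p ^ 2 / 2 := by nlinarith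
  have hk1 : p - p ^ 2 / 2 ≤ 1 / 2 := by nlinarith [sq_nonneg (1 - p)]
  nlinarith

/-- The slope `p - p ^ 2 / 2` is the one produced by the FreeGrad iterate, with `p = x / (V + x)`.
For negative `c`, its correction `p ^ 2 / 2` keeps `y` below `-p * c`, so the quadratic bound on
`exp (-y)` closes without loss. -/
lemma slope_mul_sub_le_log {p c : ℝ} (hp : 0 ≤ p) (hp1 : p ≤ 1) (hc : |c| ≤ 1) :
    (p - p ^ 2 / 2) * c - p ^ 2 * c ^ 2 / 2 ≤ Real.log (1 + (p - p ^ 2 / 2) * c) := by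
  have hpos := one_add_slope_mul_ge hp hp1 hc
  have ⟨h1, h2⟩ := abs_le.1 hc
  have hk : 0 ≤ p - p ^ 2 / 2 := by nlinarith
  rcases le_total 0 c with h0 | h0
  · have hu : 0 ≤ (p - p ^ 2 / 2) * c := mul_nonneg hk h0
    have hup : (p - p ^ 2 / 2) * c ≤ p * c := by gcongr; nlinarith
    refine le_trans ?_ (Real.le_log_one_add_of_nonneg hu)
    generalize (p - p ^ 2 / 2) * c = u at *
    rw [le_div_iff₀ (by linarith)]
    have : u ^ 2 ≤ p ^ 2 * c ^ 2 := by rw [← mul_pow]; gcongr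
    nlinarith [mul_nonneg hu (mul_nonneg hu hu)]
  · rw [Real.le_log_iff_exp_le (by linarith)]
    set y := p ^ 2 * c ^ 2 / 2 - (p - p ^ 2 / 2) * c with hy
    have hy0 : 0 ≤ y := by nlinarith [mul_nonneg hk (neg_nonneg.2 h0), sq_nonneg (p * c)]
    have hy1 : y ≤ p * (-c) := by
      have : p * (-c) - y = p ^ 2 * (-c) * (1 + c) / 2 := by rw [hy]; ring
      have : 0 ≤ p ^ 2 * (-c) * (1 + c) / 2 := by
        have := neg_nonneg.2 h0
        have : 0 ≤ 1 + c := by linarith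
        positivity
      linarith
    have h3 := exp_neg_le_quadratic hy0
    have h4 : y ^ 2 ≤ (p * (-c)) ^ 2 := by gcongr
    have h5 : (p - p ^ 2 / 2) * c - p ^ 2 * c ^ 2 / 2 = -y := by rw [hy]; ring
    rw [h5]
    refine h3.trans ?_
    nlinarith

lemma div_two_add_le_half_log {r V : ℝ} (hV : 0 < V) :
    r ^ 2 / (2 * V + r ^ 2) ≤ Real.log (1 + r ^ 2 / V) / 2 := by
  have h := Real.le_log_one_add_of_nonneg (x := r ^ 2 / V) (by positivity)
  have : 2 * (r ^ 2 / V) / (r ^ 2 / V + 2) = 2 * (r ^ 2 / (2 * V + r ^ 2)) := by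
    field_simp
    ring
  linarith

/-- The exponent inequality when the new sum is not obtuse, or the old sum is long. -/
lemma exponent_step_of_long {V x r c z : ℝ} (hV : 0 < V) (hx : 0 ≤ x) (hr : 0 ≤ r) (hr1 : r ≤ 1)
    (hc : |c| ≤ r) (hz : 0 ≤ z) (hz2 : z ^ 2 = x ^ 2 + 2 * x * c + r ^ 2)
    (hcase : 0 ≤ c ∨ r ≤ x) :
    z ^ 2 / (2 * (V + r ^ 2) + 2 * z) ≤ x ^ 2 / (2 * V + 2 * x) +
      ((x / (V + x) - (x / (V + x)) ^ 2 / 2) * c - (x / (V + x)) ^ 2 * c ^ 2 / 2) +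
      r ^ 2 / (2 * V + r ^ 2) := by
  have hrr : r ^ 2 ≤ r := pow_le_of_le_one hr hr1 two_ne_zero
  have ⟨h1, h2⟩ := abs_le.1 hc
  have hc2 : c ^ 2 ≤ r ^ 2 := sq_le_sq' h1 h2
  have hP : 0 < V + x := by linarith
  have hzl : x + c ≤ z := by
    refine (le_abs_self _).trans (abs_le_of_sq_le_sq ?_ hz)
    linarith [add_sq x c]
  have hM : 0 < V + r ^ 2 + x + c := by
    have := sq_nonneg r
    rcases hcase with h | h <;> linarith
  have hle : z ^ 2 / (2 * (V + r ^ 2) + 2 * z) ≤ z ^ 2 / (2 * (V + r ^ 2 + x + c)) := by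
    apply div_le_div_of_nonneg_left (sq_nonneg z)
    · linarith
    · linarith
  refine hle.trans ?_
  rw [div_le_iff₀ (by linarith)]
  set p := x / (V + x) with hp
  have hpx : p * (V + x) = x := by rw [hp]; field_simp
  have hp0 : 0 ≤ p := by positivity
  have hp1 : p ≤ 1 := by rw [hp, div_le_one hP]; linarith
  have hxx : x ^ 2 / (2 * V + 2 * x) = p * x / 2 := by rw [hp]; field_simp
  rw [hxx, hz2]
  set t := r ^ 2 / (2 * V + r ^ 2) with ht
  have hD : 0 < 2 * V + r ^ 2 := by positivity
  have htD : t * (2 * V + r ^ 2) = r ^ 2 := by rw [ht]; field_simp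
  have ht0 : 0 ≤ t := by positivity
  have key : (p * x / 2 + ((p - p ^ 2 / 2) * c - p ^ 2 * c ^ 2 / 2) + t) *
      (2 * (V + r ^ 2 + x + c)) - (x ^ 2 + 2 * x * c + r ^ 2) =
      2 * c * (r ^ 2 + c) * (p - p ^ 2 / 2 - p ^ 2 * c / 2) + p * x * (r ^ 2 - c ^ 2) +
        t * (2 * x + r ^ 2 + 2 * c) := by
    linear_combination (x + 2 * c - p * c - p * c ^ 2) * hpx + htD
  suffices 0 ≤ 2 * c * (r ^ 2 + c) * (p - p ^ 2 / 2 - p ^ 2 * c / 2) + p * x * (r ^ 2 - c ^ 2) +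
        t * (2 * x + r ^ 2 + 2 * c) by linarith
  have h3 : 0 ≤ p * x * (r ^ 2 - c ^ 2) := mul_nonneg (by positivity) (by linarith)
  have hpp : p ^ 2 ≤ p := pow_le_of_le_one hp0 hp1 two_ne_zero
  -- Only the first term can be negative, and only for `-r ^ 2 < c < 0`. It is then at least `-r ^ 2
  -- * p / 2`, which the `t` term compensates because `r ≤ x`.
  rcases le_or_gt 0 c with h0 | h0
  · have h4 : 0 ≤ p - p ^ 2 / 2 - p ^ 2 * c / 2 := by nlinarith [sq_nonneg p]
    positivity
  · have hxr : r ≤ x := hcase.resolve_left h0.not_ge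
    have h4 : 0 ≤ p - p ^ 2 / 2 - p ^ 2 * c / 2 := by nlinarith [sq_nonneg p]
    have h5 : p - p ^ 2 / 2 - p ^ 2 * c / 2 ≤ p := by nlinarith [sq_nonneg p]
    rcases le_total (r ^ 2 + c) 0 with h6 | h6
    · have h7 : 0 ≤ c * (r ^ 2 + c) := mul_nonneg_of_nonpos_of_nonpos h0.le h6
      have h8 : 0 ≤ t * (2 * x + r ^ 2 + 2 * c) := mul_nonneg ht0 (by linarith [sq_nonneg r])
      have h9 := mul_nonneg h7 h4
      linarith
    · have h7 : (-c) * (r ^ 2 + c) ≤ r ^ 2 / 4 := by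
        have h10 : r ^ 2 * r ^ 2 ≤ r ^ 2 * 1 := by
          gcongr
          linarith
        have h11 := sq_nonneg (r ^ 2 + 2 * c)
        linarith
      have h8 : (-c) * (r ^ 2 + c) * (p - p ^ 2 / 2 - p ^ 2 * c / 2) ≤ r ^ 2 / 4 * p :=
        mul_le_mul h7 h5 h4 (by positivity)
      have h9 : r ^ 2 * p / 2 ≤ t * (2 * x + r ^ 2 + 2 * c) := by
        have : t * x ≤ t * (2 * x + r ^ 2 + 2 * c) := by gcongr; linarith
        refine le_trans ?_ this
        rw [ht, hp, div_mul_eq_mul_div, mul_div_assoc', div_div, div_le_div_iff₀ (by positivity) hD]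
        gcongr
        linarith
      linarith

/-- The exponent inequality when the old sum is short and the gradient points against it. -/
lemma exponent_step_of_short {V x r c z : ℝ} (hx : 0 ≤ x) (hr : 0 < r) (hr1 : r ≤ 1)
    (hV : r ^ 2 / 9 ≤ V) (hc : -r ≤ c) (hc0 : c ≤ 0) (hz : 0 ≤ z)
    (hz2 : z ^ 2 = x ^ 2 + 2 * x * c + r ^ 2) (hxr : x ≤ r) :
    z ^ 2 / (2 * (V + r ^ 2) + 2 * z) ≤ x ^ 2 / (2 * V + 2 * x) + x / (V + x) * c +
      r ^ 2 / (2 * V + r ^ 2) := by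
  have hV0 : 0 < V := lt_of_lt_of_le (by positivity) hV
  -- Measuring everything in units of `r` reduces the claim to `short_sum_polynomial` with `m = a *
  -- b`.
  obtain ⟨a, rfl⟩ : ∃ a, x = r * a := ⟨x / r, by field_simp⟩
  obtain ⟨b, rfl⟩ : ∃ b, c = -(r * b) := ⟨-c / r, by field_simp⟩
  obtain ⟨y, rfl⟩ : ∃ y, V = r * y := ⟨V / r, by field_simp⟩
  have ha : 0 ≤ a := nonneg_of_mul_nonneg_right hx hr
  have hb : 0 ≤ b := nonneg_of_mul_nonneg_right (by linarith) hr
  have hy : 0 < y := (mul_pos_iff_of_pos_left hr).1 hV0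
  have ha1 : a ≤ 1 := by
    by_contra! h
    nlinarith
  have hb1 : b ≤ 1 := by
    by_contra! h
    nlinarith
  have hyr : r / 9 ≤ y := by
    by_contra! h
    nlinarith
  have hma : a * b ≤ a := by nlinarith
  have hm : 0 ≤ a * b := by positivity
  have hzl : r * (1 - a * b) ≤ z := by
    refine (le_abs_self _).trans (abs_le_of_sq_le_sq ?_ hz)
    rw [hz2]
    have : 0 ≤ (r * a) ^ 2 * (1 - b ^ 2) := mul_nonneg (by positivity) (by nlinarith)
    linarith
  have hz3 : z ^ 2 = r ^ 2 * (a ^ 2 - 2 * (a * b) + 1) := by rw [hz2]; ring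
  have hpoly := short_sum_polynomial ha1 hm hma hr.le hr1 hyr
  have hN : 0 < y + r + 1 - a * b := by linarith
  have hle : z ^ 2 / (2 * (r * y + r ^ 2) + 2 * z) ≤
      z ^ 2 / (2 * r * (y + r + 1 - a * b)) := by
    apply div_le_div_of_nonneg_left (sq_nonneg z)
    · positivity
    · linarith
  refine hle.trans ?_
  rw [hz3]
  have e1 : r ^ 2 * (a ^ 2 - 2 * (a * b) + 1) / (2 * r * (y + r + 1 - a * b)) =
      r * ((a ^ 2 - 2 * (a * b) + 1) / (2 * (y + r + 1 - a * b))) := by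
    field_simp
  have hya : 0 < y + a := by linarith
  have hyr2 : 0 < 2 * y + r := by linarith
  have e2 : (r * a) ^ 2 / (2 * (r * y) + 2 * (r * a)) + r * a / (r * y + r * a) * -(r * b) +
      r ^ 2 / (2 * (r * y) + r ^ 2) =
      r * ((a ^ 2 - 2 * (a * b)) / (2 * (y + a)) + 1 / (2 * y + r)) := by
    have : 2 * (r * y) + 2 * (r * a) = r * (2 * (y + a)) := by ring
    rw [this]
    have : r * y + r * a = r * (y + a) := by ring
    rw [this]
    have : 2 * (r * y) + r ^ 2 = r * (2 * y + r) := by ring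
    rw [this]
    field_simp
    ring
  rw [e1, e2]
  gcongr
  rw [div_add_div _ _ (by positivity) (by positivity),
    div_le_div_iff₀ (by positivity) (by positivity)]
  linarith

lemma exp_six_sevenths_le : Real.exp (6 / 7) ≤ 5 / 2 := by
  have h : Real.exp (6 / 7) ^ 7 ≤ (5 / 2) ^ 7 := by
    rw [← Real.exp_nat_mul]
    have : ((7 : ℕ) : ℝ) * (6 / 7) = (6 : ℕ) * 1 := by norm_num
    rw [this, Real.exp_nat_mul]
    calc Real.exp 1 ^ 6 ≤ 2.7182818286 ^ 6 := by
          gcongr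
          exact Real.exp_one_lt_d9.le
      _ ≤ _ := by norm_num
  exact le_of_pow_le_pow_left₀ (by norm_num) (by norm_num) h

/-- The logarithmic form of the one-step inequality, for a hint equal to one. -/
lemma log_potential_step {V x r c z : ℝ} (hV : 0 < V) (hx : 0 ≤ x) (hr : 0 ≤ r) (hr1 : r ≤ 1)
    (hc : |c| ≤ r) (hz : 0 ≤ z) (hz2 : z ^ 2 = x ^ 2 + 2 * x * c + r ^ 2) :
    z ^ 2 / (2 * (V + r ^ 2) + 2 * z) ≤ x ^ 2 / (2 * V + 2 * x) +
      Real.log (1 + (x / (V + x) - (x / (V + x)) ^ 2 / 2) * c) +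
      Real.log (1 + r ^ 2 / V) / 2 := by
  have hP : 0 < V + x := by linarith
  have hp0 : 0 ≤ x / (V + x) := by positivity
  have hp1 : x / (V + x) ≤ 1 := by rw [div_le_one hP]; linarith
  have hlog := slope_mul_sub_le_log hp0 hp1 (hc.trans hr1)
  have hlog2 := div_two_add_le_half_log (r := r) hV
  have ⟨h1, h2⟩ := abs_le.1 hc
  by_cases hcase : 0 ≤ c ∨ r ≤ x
  · have := exponent_step_of_long hV hx hr hr1 hc hz hz2 hcase
    linarith
  push Not at hcase
  obtain ⟨hc0, hxr⟩ := hcase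
  have hr0 : 0 < r := by linarith
  rcases le_total (r ^ 2 / 9) V with hVr | hVr
  · have := exponent_step_of_short hx hr0 hr1 hVr h1 hc0.le hz hz2 hxr.le
    have h3 : 0 ≤ (x / (V + x)) ^ 2 * (-c) * (1 + c) / 2 := by
      have := neg_pos.2 hc0
      have : 0 ≤ 1 + c := by linarith
      positivity
    linarith
  -- For tiny `V` crude bounds suffice: the left side is at most `3 / 7`, while the two logarithms
  -- give at least `log (1 / 2) + log 10 / 2 = log (5 / 2) / 2`.
  · have h3 := one_add_slope_mul_ge hp0 hp1 (hc.trans hr1)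
    have h4 : Real.log (1 / 2) ≤ Real.log (1 + (x / (V + x) - (x / (V + x)) ^ 2 / 2) * c) :=
      Real.log_le_log (by norm_num) h3
    have h5 : Real.log 10 ≤ Real.log (1 + r ^ 2 / V) := by
      apply Real.log_le_log (by norm_num)
      have : 9 ≤ r ^ 2 / V := by rw [le_div_iff₀ hV]; linarith
      linarith
    have h6 : 6 / 7 ≤ Real.log (5 / 2) := by
      rw [Real.le_log_iff_exp_le (by norm_num)]
      exact exp_six_sevenths_le
    have h7 : Real.log (5 / 2) = Real.log 10 + 2 * Real.log (1 / 2) := by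
      have : (2 : ℝ) * Real.log (1 / 2) = Real.log ((1 / 2) ^ 2) := by
        rw [Real.log_pow]; norm_num
      rw [this, ← Real.log_mul (by norm_num) (by norm_num)]
      norm_num
    have h8 : z ^ 2 ≤ 2 * r ^ 2 := by
      have : x ^ 2 ≤ r ^ 2 := by gcongr
      have : x * c ≤ 0 := mul_nonpos_of_nonneg_of_nonpos hx hc0.le
      linarith
    have h9 : z ≤ 3 / 2 := by
      by_contra! h
      nlinarith
    have h10 : z ^ 2 / (2 * (V + r ^ 2) + 2 * z) ≤ 3 / 7 := by
      rw [div_le_iff₀ (by positivity)]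
      nlinarith
    have h11 : 0 ≤ x ^ 2 / (2 * V + 2 * x) := by positivity
    linarith

lemma exp_potential_step_unit {V x r c z : ℝ} (hV : 0 < V) (hx : 0 ≤ x) (hr : 0 ≤ r)
    (hr1 : r ≤ 1) (hc : |c| ≤ r) (hz : 0 ≤ z) (hz2 : z ^ 2 = x ^ 2 + 2 * x * c + r ^ 2) :
    Real.exp (z ^ 2 / (2 * (V + r ^ 2) + 2 * z)) / √(V + r ^ 2) ≤
      Real.exp (x ^ 2 / (2 * V + 2 * x)) / √V *
        (1 + (2 * V + x) / (2 * (V + x) ^ 2) * (x * c)) := by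
  have hP : 0 < V + x := by linarith
  have hk : (2 * V + x) / (2 * (V + x) ^ 2) * (x * c) =
      (x / (V + x) - (x / (V + x)) ^ 2 / 2) * c := by
    field_simp
    ring
  have hp0 : 0 ≤ x / (V + x) := by positivity
  have hp1 : x / (V + x) ≤ 1 := by rw [div_le_one hP]; linarith
  have h3 := one_add_slope_mul_ge hp0 hp1 (hc.trans hr1)
  have h := Real.exp_le_exp.2 (log_potential_step hV hx hr hr1 hc hz hz2)
  rw [Real.exp_add, Real.exp_add, Real.exp_log (by linarith), Real.exp_half,
    Real.exp_log (by positivity)] at h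
  rw [hk, div_le_iff₀ (by positivity)]
  refine h.trans (le_of_eq ?_)
  have hs : √(V + r ^ 2) = √V * √(1 + r ^ 2 / V) := by
    rw [← Real.sqrt_mul hV.le]
    congr 1
    field_simp
  rw [hs]
  field_simp

/-! ### The potential and its one-step decrease -/

section
variable {E : Type*} [NormedAddCommGroup E]

/-- The FreeGrad potential without the factor `h₁²`. -/
noncomputable def freeGradPotential (h V : ℝ) (G : E) : ℝ :=
  Real.exp (‖G‖ ^ 2 / (2 * V + 2 * h * ‖G‖)) / √V

lemma freeGradPotential_nonneg (h V : ℝ) (G : E) : 0 ≤ freeGradPotential h V G := by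
  unfold freeGradPotential
  positivity

lemma freeGradPotential_antitone {h h' V : ℝ} (hV : 0 < V) (hh : 0 ≤ h) (hle : h ≤ h') (G : E) :
    freeGradPotential h' V G ≤ freeGradPotential h V G := by
  unfold freeGradPotential
  gcongr

lemma freeGradPotential_step [InnerProductSpace ℝ E] {h V : ℝ} (hV : 0 < V) (hh : 0 < h)
    (G g : E) (hg : ‖g‖ ≤ h) :
    freeGradPotential h (V + ‖g‖ ^ 2) (G + g) ≤ freeGradPotential h V G *
      (1 + (2 * V + h * ‖G‖) / (2 * (V + h * ‖G‖) ^ 2) * inner ℝ g G) := by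
  -- `c` is the component of `g / h` along `G`. Dividing gradients by `h` and `V` by `h ^ 2` leaves
  -- the exponents unchanged and reduces to hint one.
  obtain ⟨c, hc, hcG⟩ : ∃ c : ℝ, |c| ≤ ‖g‖ / h ∧ inner ℝ g G = h * ‖G‖ * c := by
    rcases eq_or_ne G 0 with rfl | hG
    · exact ⟨0, by rw [abs_zero]; positivity, by simp⟩
    · have hG' : 0 < ‖G‖ := norm_pos_iff.2 hG
      refine ⟨inner ℝ g G / (h * ‖G‖), ?_, by field_simp⟩
      rw [abs_div, abs_of_pos (by positivity : 0 < h * ‖G‖),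
        div_le_div_iff₀ (by positivity) hh]
      nlinarith [abs_real_inner_le_norm g G]
  have hz2 : (‖G + g‖ / h) ^ 2 = (‖G‖ / h) ^ 2 + 2 * (‖G‖ / h) * c + (‖g‖ / h) ^ 2 := by
    have : ‖G + g‖ ^ 2 = ‖G‖ ^ 2 + 2 * (h * ‖G‖ * c) + ‖g‖ ^ 2 := by
      rw [norm_add_sq_real, real_inner_comm, hcG]
    rw [div_pow, this]
    field_simp
  have hstep := exp_potential_step_unit (V := V / h ^ 2) (by positivity)
    (by positivity : 0 ≤ ‖G‖ / h) (by positivity : 0 ≤ ‖g‖ / h) (by rwa [div_le_one hh]) hc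
    (by positivity) hz2
  unfold freeGradPotential
  have hA : V / h ^ 2 + (‖g‖ / h) ^ 2 = (V + ‖g‖ ^ 2) / h ^ 2 := by field_simp
  have e1 : (‖G + g‖ / h) ^ 2 / (2 * ((V + ‖g‖ ^ 2) / h ^ 2) + 2 * (‖G + g‖ / h)) =
      ‖G + g‖ ^ 2 / (2 * (V + ‖g‖ ^ 2) + 2 * h * ‖G + g‖) := by
    field_simp
  have e2 : (‖G‖ / h) ^ 2 / (2 * (V / h ^ 2) + 2 * (‖G‖ / h)) =
      ‖G‖ ^ 2 / (2 * V + 2 * h * ‖G‖) := by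
    field_simp
  have e3 : (2 * (V / h ^ 2) + ‖G‖ / h) / (2 * (V / h ^ 2 + ‖G‖ / h) ^ 2) * (‖G‖ / h * c) =
      (2 * V + h * ‖G‖) / (2 * (V + h * ‖G‖) ^ 2) * inner ℝ g G := by
    rw [hcG]
    have : 0 < V + h * ‖G‖ := by positivity
    field_simp
  rw [hA, e1, e2, e3, Real.sqrt_div' _ (by positivity), Real.sqrt_div' _ (by positivity),
    Real.sqrt_sq hh.le, ← div_mul, ← div_mul] at hstep
  exact le_of_mul_le_mul_right (hstep.trans_eq (mul_right_comm _ _ _)) hh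

end

/-! ### The convex conjugate of the potential -/

lemma lnPlus_nonneg (x : ℝ) : 0 ≤ lnPlus x := le_max_left _ _

lemma lnPlus_le_lnPlus {x y : ℝ} (hx : 0 ≤ x) (hxy : x ≤ y) : lnPlus x ≤ lnPlus y := by
  rcases hx.eq_or_lt with rfl | hx
  · simp [lnPlus]
  · exact max_le_max le_rfl (Real.log_le_log hx hxy)

lemma le_exp_lnPlus {x : ℝ} (hx : 0 ≤ x) : x ≤ Real.exp (lnPlus x) := by
  rcases hx.eq_or_lt with rfl | hx
  · positivity
  · rw [← Real.log_le_iff_le_exp hx]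
    exact le_max_right _ _

lemma mul_one_add_sub_lnPlus_le_exp {x q : ℝ} (hx : 0 ≤ x) (hq : lnPlus x ≤ q) :
    x * (1 + (q - lnPlus x)) ≤ Real.exp q := by
  calc x * (1 + (q - lnPlus x)) ≤ Real.exp (lnPlus x) * Real.exp (q - lnPlus x) := by
        gcongr
        · exact le_exp_lnPlus hx
        · linarith [Real.add_one_le_exp (q - lnPlus x)]
    _ = Real.exp q := by rw [← Real.exp_add]; ring_nf

/-- The bound on the convex conjugate of the FreeGrad potential. -/
lemma mul_norm_sub_freeGradPotential_le {E : Type*} [NormedAddCommGroup E] {ω h₁ h V b : ℝ}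
    (hω : 0 ≤ ω) (h₁pos : 0 < h₁) (hpos : 0 < h) (hV : 0 < V) (hb : 2 * V / h₁ ^ 2 ≤ b)
    (hb' : 4 * h * √V / h₁ ^ 2 ≤ 2 * b) (G : E) :
    ω * ‖G‖ - h₁ ^ 2 * freeGradPotential h V G ≤
      2 * ω * √(V * lnPlus (ω * b)) + 4 * h * ω * lnPlus (2 * ω * b) := by
  have hb0 : 0 < b := lt_of_lt_of_le (by positivity) hb
  rw [div_le_iff₀ (by positivity)] at hb hb'
  have hsV : 0 < √V := Real.sqrt_pos.2 hV
  have hVV : √V ^ 2 = V := Real.sq_sqrt hV.le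
  have hpot : 0 ≤ h₁ ^ 2 * freeGradPotential h V G :=
    mul_nonneg (sq_nonneg _) (freeGradPotential_nonneg _ _ _)
  have hL2 : 0 ≤ 4 * h * ω * lnPlus (2 * ω * b) :=
    mul_nonneg (by positivity) (lnPlus_nonneg _)
  have hL1 : 0 ≤ 2 * ω * √(V * lnPlus (ω * b)) := by positivity
  -- The exponent is at least `‖G‖ ^ 2 / (4 * V)` in the first regime (sub-Gaussian) and at least
  -- `‖G‖ / (4 * h)` in the second (sub-exponential); they yield the square-root and the linear
  -- logarithmic term.
  rcases le_total (h * ‖G‖) V with hc | hc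
  · set u := ‖G‖ / (2 * √V) with hu
    have hGu : ‖G‖ = 2 * √V * u := by rw [hu]; field_simp
    have hu0 : 0 ≤ u := by positivity
    have hexp : Real.exp (u ^ 2) / √V ≤ freeGradPotential h V G := by
      unfold freeGradPotential
      gcongr
      rw [hu, div_pow, mul_pow, hVV]
      gcongr
      linarith
    have hs := Real.sq_sqrt (lnPlus_nonneg (ω * b))
    have hs0 := Real.sqrt_nonneg (lnPlus (ω * b))
    rw [Real.sqrt_mul hV.le]
    set s := √(lnPlus (ω * b)) with hsdef
    rcases le_total u s with hus | hus
    · have : ω * ‖G‖ ≤ 2 * ω * (√V * s) := by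
        rw [hGu]
        calc ω * (2 * √V * u) ≤ ω * (2 * √V * s) := by gcongr
          _ = _ := by ring
      linarith
    · have h1 : lnPlus (ω * b) ≤ u ^ 2 := by rw [← hs]; gcongr
      have h2 := mul_one_add_sub_lnPlus_le_exp (by positivity : 0 ≤ ω * b) h1
      rw [← hs] at h2
      have h3 : u - s ≤ 1 + (u ^ 2 - s ^ 2) := by nlinarith [sq_nonneg (u - s - 1)]
      have h4 : ω * b * (u - s) ≤ Real.exp (u ^ 2) := le_trans (by gcongr) h2
      have h5 : 2 * √V * ω * (u - s) ≤ h₁ ^ 2 * (Real.exp (u ^ 2) / √V) := by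
        rw [mul_div_assoc', le_div_iff₀ hsV]
        calc 2 * √V * ω * (u - s) * √V = 2 * √V ^ 2 * (ω * (u - s)) := by ring
          _ ≤ b * h₁ ^ 2 * (ω * (u - s)) := by
              rw [hVV]
              exact mul_le_mul_of_nonneg_right hb (mul_nonneg hω (by linarith))
          _ = h₁ ^ 2 * (ω * b * (u - s)) := by ring
          _ ≤ _ := by gcongr
      have h6 : h₁ ^ 2 * (Real.exp (u ^ 2) / √V) ≤ h₁ ^ 2 * freeGradPotential h V G := by gcongr
      rw [hGu]
      linarith
  · set q := ‖G‖ / (4 * h) with hq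
    have hGq : ‖G‖ = 4 * h * q := by rw [hq]; field_simp
    have hG0 : 0 < ‖G‖ := (mul_pos_iff_of_pos_left hpos).1 (hV.trans_le hc)
    have hexp : Real.exp q / √V ≤ freeGradPotential h V G := by
      unfold freeGradPotential
      gcongr
      rw [hq, div_le_div_iff₀ (by positivity) (by positivity)]
      nlinarith
    rcases le_total q (lnPlus (2 * ω * b)) with hql | hql
    · have : ω * ‖G‖ ≤ 4 * h * ω * lnPlus (2 * ω * b) := by
        rw [hGq]
        calc ω * (4 * h * q) ≤ ω * (4 * h * lnPlus (2 * ω * b)) := by gcongr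
          _ = _ := by ring
      linarith
    · have h2 := mul_one_add_sub_lnPlus_le_exp (by positivity : 0 ≤ 2 * ω * b) hql
      have h4 : 2 * ω * b * (q - lnPlus (2 * ω * b)) ≤ Real.exp q :=
        le_trans (by gcongr; linarith) h2
      have h5 : 4 * h * ω * (q - lnPlus (2 * ω * b)) ≤ h₁ ^ 2 * (Real.exp q / √V) := by
        rw [mul_div_assoc', le_div_iff₀ hsV]
        calc 4 * h * ω * (q - lnPlus (2 * ω * b)) * √V
            = 4 * h * √V * (ω * (q - lnPlus (2 * ω * b))) := by ring
          _ ≤ 2 * b * h₁ ^ 2 * (ω * (q - lnPlus (2 * ω * b))) :=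
              mul_le_mul_of_nonneg_right hb' (mul_nonneg hω (by linarith))
          _ = h₁ ^ 2 * (2 * ω * b * (q - lnPlus (2 * ω * b))) := by ring
          _ ≤ _ := by gcongr
      have h6 : h₁ ^ 2 * (Real.exp q / √V) ≤ h₁ ^ 2 * freeGradPotential h V G := by gcongr
      rw [hGq]
      linarith

/-! ### Epochs and restarts -/

section
variable {d : ℕ}

lemma inner_freeGradIterate_le {h₁ h V : ℝ} (hV : 0 < V) (hh : 0 < h)
    (G g : EuclideanSpace ℝ (Fin d)) (hg : ‖g‖ ≤ h) :
    inner ℝ g (freeGradIterate h₁ h V G) ≤ h₁ ^ 2 * freeGradPotential h V G -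
      h₁ ^ 2 * freeGradPotential h (V + ‖g‖ ^ 2) (G + g) := by
  have hstep := mul_le_mul_of_nonneg_left (freeGradPotential_step hV hh G g hg) (sq_nonneg h₁)
  have hcoef : inner ℝ g (freeGradIterate h₁ h V G) = -(h₁ ^ 2 * (freeGradPotential h V G *
      ((2 * V + h * ‖G‖) / (2 * (V + h * ‖G‖) ^ 2) * inner ℝ g G))) := by
    unfold freeGradIterate freeGradPotential
    rw [inner_neg_right, real_inner_smul_right]
    field_simp
  rw [hcoef]
  linarith

variable {g : ℕ → EuclideanSpace ℝ (Fin d)} {h : ℕ → ℝ}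

lemma IsHintSequence.norm_le (hh : IsHintSequence g h) {t : ℕ} (ht : 1 ≤ t) : ‖g t‖ ≤ h t := by
  refine le_trans ?_ (hh.runningMax_le t ht)
  have := Finset.le_sup (f := fun s => ‖g s‖₊) (Finset.mem_Icc.2 ⟨ht, le_rfl⟩)
  exact_mod_cast this

lemma IsHintSequence.pos (hh : IsHintSequence g h) (hg : 0 < ‖g 1‖) {t : ℕ} (ht : 1 ≤ t) :
    0 < h t :=
  (hg.trans_le (hh.norm_le le_rfl)).trans_le (hh.monotoneOn (by simp) ht ht)

lemma epochStart_zero : epochStart g h 0 = 1 := rfl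

lemma epochStart_succ (t : ℕ) : epochStart g h (t + 1) =
    if h (t + 1) / h (epochStart g h t) > (∑ s ∈ Finset.Icc 1 t, ‖g s‖ / h s) + 2
    then t + 1 else epochStart g h t := rfl

lemma one_le_epochStart (t : ℕ) : 1 ≤ epochStart g h t := by
  induction t with
  | zero => exact le_rfl
  | succ t ih =>
    rw [epochStart_succ]
    split_ifs
    · omega
    · exact ih

lemma epochStart_one : epochStart g h 1 = 1 := by
  rw [epochStart_succ, epochStart_zero]
  simp

lemma epochStart_le {t : ℕ} (ht : 1 ≤ t) : epochStart g h t ≤ t := by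
  induction t, ht using Nat.le_induction with
  | base =>
    rw [epochStart_succ, epochStart_zero]
    split_ifs <;> simp
  | succ t _ ih =>
    rw [epochStart_succ]
    split_ifs <;> omega

/-- The statistic `V` of the current epoch after round `t`. -/
noncomputable def epochVariance (g : ℕ → EuclideanSpace ℝ (Fin d)) (h : ℕ → ℝ) (t : ℕ) : ℝ :=
  h (epochStart g h t) ^ 2 + ∑ s ∈ Finset.Ico (epochStart g h t) (t + 1), ‖g s‖ ^ 2

/-- The sum of the sub-gradients of the current epoch after round `t`. -/
noncomputable def epochSum (g : ℕ → EuclideanSpace ℝ (Fin d)) (h : ℕ → ℝ) (t : ℕ) :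
    EuclideanSpace ℝ (Fin d) :=
  ∑ s ∈ Finset.Ico (epochStart g h t) (t + 1), g s

/-- The potential of the current epoch after round `t`. -/
noncomputable def epochPotential (g : ℕ → EuclideanSpace ℝ (Fin d)) (h : ℕ → ℝ) (t : ℕ) : ℝ :=
  h (epochStart g h t) ^ 2 * freeGradPotential (h t) (epochVariance g h t) (epochSum g h t)

/-- The factor `∑_{s < t} ‖g_s‖ / h_s + 2` that triggers restarts. -/
noncomputable def restartThreshold (g : ℕ → EuclideanSpace ℝ (Fin d)) (h : ℕ → ℝ) (t : ℕ) : ℝ :=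
  (∑ s ∈ Finset.Ico 1 t, ‖g s‖ / h s) + 2

lemma epochPotential_nonneg (t : ℕ) : 0 ≤ epochPotential g h t :=
  mul_nonneg (sq_nonneg _) (freeGradPotential_nonneg _ _ _)

lemma epochVariance_pos (hpos : ∀ t, 1 ≤ t → 0 < h t) (t : ℕ) : 0 < epochVariance g h t := by
  have := hpos _ (one_le_epochStart (g := g) (h := h) t)
  unfold epochVariance
  positivity

lemma epochStart_succ_of_restart {t : ℕ}
    (hr : restartThreshold g h (t + 1) < h (t + 1) / h (epochStart g h t)) :
    epochStart g h (t + 1) = t + 1 := by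
  rw [epochStart_succ]
  exact if_pos hr

lemma epochStart_succ_of_not_restart {t : ℕ}
    (hr : ¬ restartThreshold g h (t + 1) < h (t + 1) / h (epochStart g h t)) :
    epochStart g h (t + 1) = epochStart g h t := by
  rw [epochStart_succ]
  exact if_neg hr

lemma two_le_restartThreshold (hpos : ∀ t, 1 ≤ t → 0 < h t) (t : ℕ) :
    2 ≤ restartThreshold g h t := by
  have : 0 ≤ ∑ s ∈ Finset.Ico 1 t, ‖g s‖ / h s := Finset.sum_nonneg fun s hs =>
    div_nonneg (norm_nonneg _) (hpos s (Finset.mem_Ico.1 hs).1).le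
  unfold restartThreshold
  linarith

lemma inner_freeRange_le_of_start_eq (hh : IsHintSequence g h) (hpos : ∀ t, 1 ≤ t → 0 < h t)
    {t : ℕ} (ht : 1 ≤ t) (hs : epochStart g h t = t) :
    inner ℝ (g t) (freeRange g h t) ≤ h t - epochPotential g h t := by
  have h0 := hpos t ht
  have := inner_freeGradIterate_le (h₁ := h t) (V := h t ^ 2) (by positivity) h0 0 (g t)
    (hh.norm_le ht)
  unfold freeRange epochPotential epochVariance epochSum
  rw [hs]
  simp only [Finset.Ico_self, Finset.sum_empty, add_zero, Nat.Ico_succ_singleton,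
    Finset.sum_singleton]
  rw [zero_add] at this
  refine this.trans (le_of_eq ?_)
  congr 1
  simp only [freeGradPotential, norm_zero, Real.sqrt_sq h0.le]
  field_simp
  simp

lemma inner_freeRange_succ_le_of_start_eq (hh : IsHintSequence g h)
    (hpos : ∀ t, 1 ≤ t → 0 < h t) {t : ℕ} (ht : 1 ≤ t)
    (hs : epochStart g h (t + 1) = epochStart g h t) :
    inner ℝ (g (t + 1)) (freeRange g h (t + 1)) ≤
      epochPotential g h t - epochPotential g h (t + 1) := by
  have hle : epochStart g h t ≤ t := epochStart_le ht
  have hV := epochVariance_pos (g := g) hpos t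
  have h1 := inner_freeGradIterate_le (h₁ := h (epochStart g h t)) hV (hpos (t + 1) (by omega))
    (epochSum g h t) (g (t + 1)) (hh.norm_le (by omega))
  have h2 : freeRange g h (t + 1) = freeGradIterate (h (epochStart g h t)) (h (t + 1))
      (epochVariance g h t) (epochSum g h t) := by
    unfold freeRange epochVariance epochSum
    rw [hs]
  have h3 : epochVariance g h (t + 1) = epochVariance g h t + ‖g (t + 1)‖ ^ 2 := by
    unfold epochVariance
    rw [hs, Finset.sum_Ico_succ_top (by omega), add_assoc]
  have h4 : epochSum g h (t + 1) = epochSum g h t + g (t + 1) := by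
    unfold epochSum
    rw [hs, Finset.sum_Ico_succ_top (by omega)]
  have h5 : epochPotential g h (t + 1) = h (epochStart g h t) ^ 2 * freeGradPotential (h (t + 1))
      (epochVariance g h t + ‖g (t + 1)‖ ^ 2) (epochSum g h t + g (t + 1)) := by
    rw [← h3, ← h4, ← hs, epochPotential]
  rw [h5, h2]
  have h6 : h (epochStart g h t) ^ 2 *
      freeGradPotential (h (t + 1)) (epochVariance g h t) (epochSum g h t) ≤
        epochPotential g h t := by
    unfold epochPotential
    gcongr
    exact freeGradPotential_antitone hV (hpos t ht).le
      (hh.monotoneOn (Set.mem_Ici.2 ht) (Set.mem_Ici.2 (by omega)) (by omega)) _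
  linarith

/-- The cumulative loss of FreeRange, with the potentials of the last two epochs retained. -/
lemma sum_inner_freeRange_add_le (hh : IsHintSequence g h) (hpos : ∀ t, 1 ≤ t → 0 < h t)
    {t : ℕ} (ht : 1 ≤ t) :
    (∑ s ∈ Finset.Icc 1 t, inner ℝ (g s) (freeRange g h s)) + epochPotential g h t ≤
        2 * h (epochStart g h t) ∧
      (epochStart g h t = 1 ∨ ∃ e, 1 ≤ e ∧ epochStart g h t = e + 1 ∧
        restartThreshold g h (e + 1) < h (e + 1) / h (epochStart g h e) ∧
        (∑ s ∈ Finset.Icc 1 t, inner ℝ (g s) (freeRange g h s)) + epochPotential g h t +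
          epochPotential g h e ≤ 2 * h (epochStart g h t)) := by
  induction t, ht using Nat.le_induction with
  | base =>
    have h1 : epochStart g h 1 = 1 := epochStart_one
    refine ⟨?_, Or.inl h1⟩
    have := inner_freeRange_le_of_start_eq hh hpos le_rfl h1
    rw [Finset.Icc_self, Finset.sum_singleton, h1]
    linarith [hpos 1 le_rfl]
  | succ t ht ih =>
    obtain ⟨ih1, ih2⟩ := ih
    rw [Finset.sum_Icc_succ_top (by omega)]
    by_cases hr : restartThreshold g h (t + 1) < h (t + 1) / h (epochStart g h t)
    · have hs := epochStart_succ_of_restart hr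
      have h1 := inner_freeRange_le_of_start_eq hh hpos (by omega) hs
      -- The old budget `2 * h_τ` fits in one copy of the new hint; the new epoch's initial
      -- potential uses the other.
      have h2 : 2 * h (epochStart g h t) ≤ h (t + 1) := by
        have := (two_le_restartThreshold (g := g) hpos (t + 1)).trans hr.le
        rwa [le_div_iff₀ (hpos _ (one_le_epochStart t))] at this
      have h3 := epochPotential_nonneg (g := g) (h := h) t
      rw [hs]
      exact ⟨by linarith, Or.inr ⟨t, ht, rfl, hr, by linarith⟩⟩
    · have hs := epochStart_succ_of_not_restart hr
      have h1 := inner_freeRange_succ_le_of_start_eq hh hpos ht hs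
      rw [hs]
      refine ⟨by linarith, ih2.imp id ?_⟩
      rintro ⟨e, he, hte, hre, hsum⟩
      exact ⟨e, he, hte, hre, by linarith⟩

lemma hint_le_mul_restartThreshold (hpos : ∀ t, 1 ≤ t → 0 < h t) {t : ℕ} (ht : 1 ≤ t) :
    h t ≤ h (epochStart g h t) * restartThreshold g h t := by
  have key : ∀ t, 1 ≤ t → epochStart g h t = t →
      h t ≤ h (epochStart g h t) * restartThreshold g h t := by
    intro t ht hs
    rw [hs]
    nlinarith [hpos t ht, two_le_restartThreshold (g := g) hpos t]
  obtain ⟨t, rfl⟩ : ∃ s, t = s + 1 := ⟨t - 1, by omega⟩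
  by_cases hr : restartThreshold g h (t + 1) < h (t + 1) / h (epochStart g h t)
  · exact key _ ht (epochStart_succ_of_restart hr)
  · rw [epochStart_succ_of_not_restart hr]
    rw [not_lt, div_le_iff₀ (hpos _ (one_le_epochStart t))] at hr
    linarith

lemma rangeFactor_eq (T : ℕ) :
    rangeFactor g h T = 2 * ∑ t ∈ Finset.Icc 1 T, restartThreshold g h t ^ 2 := rfl

lemma rangeFactor_nonneg (T : ℕ) : 0 ≤ rangeFactor g h T := by
  rw [rangeFactor_eq]
  positivity

lemma gradVariance_nonneg (T : ℕ) : 0 ≤ gradVariance g h T :=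
  add_nonneg (sq_nonneg _) (Finset.sum_nonneg fun _ _ => sq_nonneg _)

lemma rangeFactor_mono {s t : ℕ} (hst : s ≤ t) : rangeFactor g h s ≤ rangeFactor g h t := by
  rw [rangeFactor_eq, rangeFactor_eq]
  gcongr

lemma two_mul_restartThreshold_sq_le {t : ℕ} (ht : 1 ≤ t) :
    2 * restartThreshold g h t ^ 2 ≤ rangeFactor g h t := by
  rw [rangeFactor_eq]
  gcongr
  exact Finset.single_le_sum (f := fun t => restartThreshold g h t ^ 2)
    (fun _ _ => sq_nonneg _) (Finset.mem_Icc.2 ⟨ht, le_rfl⟩)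

/-- Without a restart, the new squared gradient is at most the squared threshold times `h_τ ^ 2`,
exactly the increment of the right side. At a restart, `V ≤ 2 * h_t ^ 2` and `8 ≤ b_t` suffice. -/
lemma two_mul_epochVariance_le (hh : IsHintSequence g h) (hpos : ∀ t, 1 ≤ t → 0 < h t)
    {t : ℕ} (ht : 1 ≤ t) :
    2 * epochVariance g h t ≤ rangeFactor g h t * h (epochStart g h t) ^ 2 := by
  have key : ∀ t, 1 ≤ t → epochStart g h t = t →
      2 * epochVariance g h t ≤ rangeFactor g h t * h (epochStart g h t) ^ 2 := by
    intro t ht hs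
    have h1 : epochVariance g h t = h t ^ 2 + ‖g t‖ ^ 2 := by
      unfold epochVariance
      rw [hs]
      simp
    have h2 : ‖g t‖ ^ 2 ≤ h t ^ 2 := by
      gcongr
      exact hh.norm_le ht
    have h3 : 8 ≤ rangeFactor g h t := by
      refine le_trans ?_ (two_mul_restartThreshold_sq_le ht)
      nlinarith [two_le_restartThreshold (g := g) hpos t]
    rw [h1, hs]
    nlinarith [sq_nonneg (h t)]
  induction t, ht using Nat.le_induction with
  | base => exact key 1 le_rfl epochStart_one
  | succ t ht ih =>
    by_cases hr : restartThreshold g h (t + 1) < h (t + 1) / h (epochStart g h t)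
    · exact key _ (by omega) (epochStart_succ_of_restart hr)
    · have hs := epochStart_succ_of_not_restart hr
      have hle : epochStart g h t ≤ t := epochStart_le ht
      have h3 : epochVariance g h (t + 1) = epochVariance g h t + ‖g (t + 1)‖ ^ 2 := by
        unfold epochVariance
        rw [hs, Finset.sum_Ico_succ_top (by omega), add_assoc]
      have h4 : ‖g (t + 1)‖ ≤ h (epochStart g h t) * restartThreshold g h (t + 1) := by
        rw [← hs]
        exact (hh.norm_le (by omega)).trans (hint_le_mul_restartThreshold hpos (by omega))
      have h5 : ‖g (t + 1)‖ ^ 2 ≤ (h (epochStart g h t) * restartThreshold g h (t + 1)) ^ 2 := by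
        gcongr
      have h6 : rangeFactor g h (t + 1) =
          rangeFactor g h t + 2 * restartThreshold g h (t + 1) ^ 2 := by
        rw [rangeFactor_eq, rangeFactor_eq, Finset.sum_Icc_succ_top (by omega)]
        ring
      rw [h3, hs, h6]
      linarith

lemma mul_norm_epochSum_sub_epochPotential_le (hh : IsHintSequence g h)
    (hpos : ∀ t, 1 ≤ t → 0 < h t) {ω : ℝ} (hω : 0 ≤ ω) {t T : ℕ} (ht : 1 ≤ t) (htT : t ≤ T) :
    ω * ‖epochSum g h t‖ - epochPotential g h t ≤
      2 * ω * √(epochVariance g h t * lnPlus (ω * rangeFactor g h T)) +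
        4 * h t * ω * lnPlus (2 * ω * rangeFactor g h T) := by
  have hb := rangeFactor_mono (g := g) (h := h) htT
  have h1 := hpos _ (one_le_epochStart (g := g) (h := h) t)
  have hV := two_mul_epochVariance_le hh hpos ht
  refine mul_norm_sub_freeGradPotential_le hω h1 (hpos t ht) (epochVariance_pos hpos t) ?_ ?_ _
  · rw [div_le_iff₀ (by positivity)]
    exact hV.trans (by gcongr)
  · rw [div_le_iff₀ (by positivity)]
    have h2 := hint_le_mul_restartThreshold (g := g) hpos ht
    have h3 := two_mul_restartThreshold_sq_le (g := g) (h := h) ht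
    have h4 := (epochVariance_pos (g := g) hpos t).le
    have h5 := Real.sq_sqrt h4
    -- AM-GM: both `h t ^ 2` and `V` are at most `b_t * h_τ ^ 2 / 2`.
    have h6 : h t * √(epochVariance g h t) ≤
        rangeFactor g h t * h (epochStart g h t) ^ 2 / 2 := by
      have h7 : h t ^ 2 ≤ (h (epochStart g h t) * restartThreshold g h t) ^ 2 := by
        have := (hpos t ht).le
        gcongr
      nlinarith [sq_nonneg (h t - √(epochVariance g h t)), sq_nonneg (h (epochStart g h t))]
    have h8 : rangeFactor g h t * h (epochStart g h t) ^ 2 ≤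
      rangeFactor g h T * h (epochStart g h t) ^ 2 := by gcongr
    linarith

lemma rangeFactor_le (hh : IsHintSequence g h) (hpos : ∀ t, 1 ≤ t → 0 < h t) {T : ℕ}
    (hT : 1 ≤ T) : rangeFactor g h T ≤ ((T : ℝ) + 1) ^ 3 := by
  have key : ∀ t, 1 ≤ t → restartThreshold g h t ^ 2 ≤ ((t : ℝ) + 1) ^ 2 := by
    intro t ht
    have h1 : ∑ s ∈ Finset.Ico 1 t, ‖g s‖ / h s ≤ ∑ s ∈ Finset.Ico 1 t, (1 : ℝ) := by
      apply Finset.sum_le_sum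
      intro s hs
      have hs1 := (Finset.mem_Ico.1 hs).1
      rw [div_le_one (hpos s hs1)]
      exact hh.norm_le hs1
    have h2 : ∑ s ∈ Finset.Ico 1 t, (1 : ℝ) = t - 1 := by
      simp [Nat.cast_sub ht]
    have h3 := two_le_restartThreshold (g := g) hpos t
    have h4 : restartThreshold g h t ≤ t + 1 := by
      unfold restartThreshold
      linarith
    gcongr
  induction T, hT using Nat.le_induction with
  | base =>
    have := key 1 le_rfl
    rw [rangeFactor_eq, Finset.Icc_self, Finset.sum_singleton]
    norm_num at this ⊢
    linarith
  | succ t ht ih =>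
    have h1 := key (t + 1) (by omega)
    rw [rangeFactor_eq] at ih ⊢
    rw [Finset.sum_Icc_succ_top (by omega)]
    push_cast at h1 ⊢
    have : (1 : ℝ) ≤ t := by exact_mod_cast ht
    nlinarith

/-- For `s < τ` the weight `h_τ / h_s` is at least one, so the restart condition multiplied by `h_τ`
dominates the unweighted sum. -/
lemma sum_norm_le_of_restart (hh : IsHintSequence g h) (hpos : ∀ t, 1 ≤ t → 0 < h t) {e : ℕ}
    (he : 1 ≤ e) (hr : restartThreshold g h (e + 1) < h (e + 1) / h (epochStart g h e)) :
    ∑ s ∈ Finset.Ico 1 (epochStart g h e), ‖g s‖ ≤ h (e + 1) := by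
  have h0 := hpos _ (one_le_epochStart (g := g) (h := h) e)
  have hle : epochStart g h e ≤ e := epochStart_le he
  rw [lt_div_iff₀ h0] at hr
  have h1 : ∑ s ∈ Finset.Ico 1 (epochStart g h e), ‖g s‖ ≤
      (∑ s ∈ Finset.Ico 1 (e + 1), ‖g s‖ / h s) * h (epochStart g h e) := by
    rw [Finset.sum_mul]
    calc ∑ s ∈ Finset.Ico 1 (epochStart g h e), ‖g s‖
        ≤ ∑ s ∈ Finset.Ico 1 (epochStart g h e), ‖g s‖ / h s * h (epochStart g h e) := by
          apply Finset.sum_le_sum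
          intro s hs
          obtain ⟨hs1, hs2⟩ := Finset.mem_Ico.1 hs
          have hs0 := hpos s hs1
          have hm : h s ≤ h (epochStart g h e) :=
            hh.monotoneOn (Set.mem_Ici.2 hs1) (Set.mem_Ici.2 (by omega)) hs2.le
          calc ‖g s‖ = ‖g s‖ / h s * h s := by field_simp
            _ ≤ _ := by gcongr
      _ ≤ _ := by
          apply Finset.sum_le_sum_of_subset_of_nonneg
          · exact Finset.Ico_subset_Ico_right (by omega)
          · intro s hs _
            have := hpos s (Finset.mem_Ico.1 hs).1
            positivity
  unfold restartThreshold at hr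
  linarith

/-! ### Combining the last two epochs -/

lemma sum_Icc_one_eq_three {M : Type*} [AddCommMonoid M] (f : ℕ → M) {a b T : ℕ} (ha : 1 ≤ a)
    (hab : a ≤ b) (hbT : b ≤ T + 1) :
    ∑ s ∈ Finset.Icc 1 T, f s = (∑ s ∈ Finset.Ico 1 a, f s) + (∑ s ∈ Finset.Ico a b, f s) +
      ∑ s ∈ Finset.Ico b (T + 1), f s := by
  rw [Finset.sum_Ico_consecutive _ ha hab, Finset.sum_Ico_consecutive _ (ha.trans hab) hbT]
  rfl

lemma sum_eq_add_epochSum_add_epochSum {e T : ℕ} (he : 1 ≤ e) (heT : e + 1 ≤ T)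
    (hTe : epochStart g h T = e + 1) :
    ∑ s ∈ Finset.Icc 1 T, g s =
      (∑ s ∈ Finset.Ico 1 (epochStart g h e), g s) + epochSum g h e + epochSum g h T := by
  have hee : epochStart g h e ≤ e := epochStart_le he
  unfold epochSum
  rw [hTe]
  exact sum_Icc_one_eq_three g (one_le_epochStart e) (by omega) (by omega)

lemma epochVariance_add_epochVariance_le (hh : IsHintSequence g h) (hpos : ∀ t, 1 ≤ t → 0 < h t)
    {e T : ℕ} (he : 1 ≤ e) (heT : e + 1 ≤ T) (hTe : epochStart g h T = e + 1) :
    epochVariance g h e + epochVariance g h T ≤ gradVariance g h T + 2 * h T ^ 2 := by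
  have hee : epochStart g h e ≤ e := epochStart_le he
  have he1 : 1 ≤ epochStart g h e := one_le_epochStart e
  have h2 := sum_Icc_one_eq_three (fun s => ‖g s‖ ^ 2) he1 (b := e + 1) (T := T)
    (by omega) (by omega)
  have h3 : 0 ≤ ∑ s ∈ Finset.Ico 1 (epochStart g h e), ‖g s‖ ^ 2 :=
    Finset.sum_nonneg fun _ _ => sq_nonneg _
  have hsq : ∀ s, 1 ≤ s → s ≤ T → h s ^ 2 ≤ h T ^ 2 := fun s hs hsT =>
    pow_le_pow_left₀ (hpos s hs).le
      (hh.monotoneOn (Set.mem_Ici.2 hs) (Set.mem_Ici.2 (hs.trans hsT)) hsT) 2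
  have h4 := hsq _ he1 (by omega)
  have h5 := hsq (e + 1) (by omega) heT
  have h6 := sq_nonneg (h 1)
  unfold epochVariance gradVariance
  rw [hTe]
  linarith

lemma sqrt_mul_add_sqrt_mul_le {A B V h L : ℝ} (hA : 0 ≤ A) (hB : 0 ≤ B) (hV : 0 ≤ V)
    (hh : 0 ≤ h) (hL : 0 ≤ L) (hle : A + B ≤ V + 2 * h ^ 2) :
    √(A * L) + √(B * L) ≤ √(2 * V * L) + h * (2 * L + 1 / 2) := by
  have h1 := Real.sq_sqrt (mul_nonneg hA hL)
  have h2 := Real.sq_sqrt (mul_nonneg hB hL)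
  have h3 := Real.sq_sqrt (by positivity : 0 ≤ 2 * V * L)
  have h4 := Real.sqrt_nonneg (2 * V * L)
  have h5 : 0 ≤ h * (2 * L + 1 / 2) := by positivity
  refine (le_abs_self _).trans (abs_le_of_sq_le_sq ?_ (by positivity))
  have h6 : (A + B) * L ≤ (V + 2 * h ^ 2) * L := by gcongr
  -- The constant `1 / 2` makes the difference the perfect square `h ^ 2 * (2 * L - 1 / 2) ^ 2`.
  have h7 : 4 * h ^ 2 * L ≤ (h * (2 * L + 1 / 2)) ^ 2 := by
    have := mul_nonneg (sq_nonneg h) (sq_nonneg (2 * L - 1 / 2))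
    linarith
  have h8 := sq_nonneg (√(A * L) - √(B * L))
  have h9 := mul_nonneg h4 h5
  generalize √(A * L) = a at *
  generalize √(B * L) = b at *
  generalize √(2 * V * L) = s at *
  generalize h * (2 * L + 1 / 2) = k at *
  linarith

end

theorem theorem3 (d : ℕ) (g : ℕ → EuclideanSpace ℝ (Fin d)) (h : ℕ → ℝ)
    (hh : IsHintSequence g h) (hg : 0 < ‖g 1‖)
    (w : EuclideanSpace ℝ (Fin d)) (T : ℕ) (hT : 1 ≤ T) :
    (∑ t ∈ Finset.Icc 1 T, inner ℝ (g t) (freeRange g h t - w) ≤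
      2 * ‖w‖ * Real.sqrt (2 * gradVariance g h T * lnPlus (‖w‖ * rangeFactor g h T)) +
        h T * (16 * ‖w‖ * lnPlus (2 * ‖w‖ * rangeFactor g h T) + 2 * ‖w‖ + 3)) ∧
    rangeFactor g h T ≤ ((T : ℝ) + 1) ^ 3 := by
  have hpos : ∀ t, 1 ≤ t → 0 < h t := fun t ht => hh.pos hg ht
  refine ⟨?_, rangeFactor_le hh hpos hT⟩
  have hmono : ∀ s, 1 ≤ s → s ≤ T → h s ≤ h T := fun s hs hsT =>
    hh.monotoneOn (Set.mem_Ici.2 hs) (Set.mem_Ici.2 hT) hsT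
  have hb := rangeFactor_nonneg (g := g) (h := h) T
  have hL : lnPlus (‖w‖ * rangeFactor g h T) ≤ lnPlus (2 * ‖w‖ * rangeFactor g h T) :=
    lnPlus_le_lnPlus (by positivity) (by
      linarith [mul_nonneg (norm_nonneg w) hb])
  have hL0 := lnPlus_nonneg (‖w‖ * rangeFactor g h T)
  have hw := norm_nonneg w
  have hhT := hpos T hT
  have hV0 := gradVariance_nonneg (g := g) (h := h) T
  have hinner : ∀ x : EuclideanSpace ℝ (Fin d), -inner ℝ x w ≤ ‖w‖ * ‖x‖ := by
    intro x
    rw [mul_comm]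
    exact (neg_le_abs _).trans (abs_real_inner_le_norm x w)
  have hIcc : Finset.Icc 1 T = Finset.Ico 1 (T + 1) := by
    ext s
    rw [Finset.mem_Icc, Finset.mem_Ico, Nat.lt_succ_iff]
  obtain ⟨hsum, hcase⟩ := sum_inner_freeRange_add_le hh hpos hT
  have hdualT := mul_norm_epochSum_sub_epochPotential_le hh hpos hw hT le_rfl
  simp only [inner_sub_right, Finset.sum_sub_distrib]
  rw [← sum_inner]
  have hτ : h (epochStart g h T) ≤ h T := hmono _ (one_le_epochStart T) (epochStart_le hT)
  have hL3 := mul_le_mul_of_nonneg_left hL (by positivity : 0 ≤ h T * ‖w‖)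
  have hL4 : 0 ≤ h T * ‖w‖ * lnPlus (‖w‖ * rangeFactor g h T) := by positivity
  have hwT : 0 ≤ h T * ‖w‖ := by positivity
  rcases hcase with h1 | ⟨e, he, hTe, hr, hsum2⟩
  · have hV : epochVariance g h T = gradVariance g h T := by
      unfold epochVariance gradVariance
      rw [h1, hIcc]
    have hG : epochSum g h T = ∑ s ∈ Finset.Icc 1 T, g s := by
      unfold epochSum
      rw [h1, hIcc]
    rw [hV, hG] at hdualT
    have h2 := hinner (∑ s ∈ Finset.Icc 1 T, g s)
    have h3 : √(gradVariance g h T * lnPlus (‖w‖ * rangeFactor g h T)) ≤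
        √(2 * gradVariance g h T * lnPlus (‖w‖ * rangeFactor g h T)) := by
      gcongr
      linarith
    have h4 := mul_le_mul_of_nonneg_left h3 (by positivity : 0 ≤ 2 * ‖w‖)
    linarith
  · have heT : e + 1 ≤ T := hTe ▸ epochStart_le hT
    have hee : epochStart g h e ≤ e := epochStart_le he
    have he1 : 1 ≤ epochStart g h e := one_le_epochStart e
    have hduale := mul_norm_epochSum_sub_epochPotential_le (T := T) hh hpos hw he (by omega)
    have hsplit := sum_eq_add_epochSum_add_epochSum (g := g) he heT hTe
    have hearly : ‖∑ s ∈ Finset.Ico 1 (epochStart g h e), g s‖ ≤ h T :=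
      (norm_sum_le _ _).trans ((sum_norm_le_of_restart hh hpos he hr).trans
        (hmono _ (by omega) heT))
    have hVV := epochVariance_add_epochVariance_le hh hpos he heT hTe
    have hsq := mul_le_mul_of_nonneg_left (sqrt_mul_add_sqrt_mul_le
      (epochVariance_pos (g := g) hpos e).le (epochVariance_pos (g := g) hpos T).le hV0 hhT.le
        hL0 hVV) (by positivity : 0 ≤ 2 * ‖w‖)
    have h2 := hinner (∑ s ∈ Finset.Ico 1 (epochStart g h e), g s)
    have h3 := mul_le_mul_of_nonneg_left hearly hw
    have h4 := hinner (epochSum g h e)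
    have h5 := hinner (epochSum g h T)
    have h6 : h e * (‖w‖ * lnPlus (2 * ‖w‖ * rangeFactor g h T)) ≤
        h T * (‖w‖ * lnPlus (2 * ‖w‖ * rangeFactor g h T)) :=
      mul_le_mul_of_nonneg_right (hmono e he (by omega)) (mul_nonneg hw (lnPlus_nonneg _))
    rw [hsplit, inner_add_left, inner_add_left]
    -- The logarithmic coefficient is `4 + 4` from the conjugates plus `4` from merging the roots;
    -- the roots and the early gradients each add one `h T * ‖w‖`.
    linarith
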